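/- Let $G$ be an abelian topological group (a group given without topology carries the discrete one). An \emph{exponential} on $G$ is a continuous homomorphism $e:G\to(\mathbb{C}\setminus\{0\},\cdot)$. A \emph{polynomial} on $G$ is a function $x\mapsto P(a_1(x),\dots,a_k(x))$ with $P$ a complex polynomial in $k$ variables and $a_1,\dots,a_k:G\to\mathbb{C}$ continuous additive functions. An \emph{exponential monomial corresponding to} $e$ is a product $p\cdot e$ of a polynomial $p$ and the exponential $e$. A distribution on $\mathbb{R}^d$ is called an exponential monomial corresponding to $e$ if it is given by integration against such a function on $\mathbb{R}^d$. For $\varphi:G\to\mathbb{C}$ and $y\in G$ put $\Delta_{\varphi;y}f(x)=f(x+y)-\varphi(y)f(x)$ for functions $f:G\to\mathbb{C}$, and, for $G=\mathbb{R}^d$, $\Delta_{\varphi;y}u=\tau_yu-\varphi(y)u$ for distributions $u$, where $(\tau_yu)(\psi)=u(\tau_{-y}\psi)$ and $\tau_{-y}\psi(x)=\psi(x-y)$ for test functions $\psi$. \textbf{Theorem.} Let $t$ be a positive integer, and suppose that one of the following holds: \begin{enumerate} \item $G$ is a finitely generated abelian group with generators $h_1,\dots,h_t$, and $f:G\to\mathbb{C}$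 is a nonzero function; \item $G$ is a topological abelian group in which $h_1,\dots,h_t$ generate a dense subgroup, and $f:G\to\mathbb{C}$ is a nonzero continuous function; \item $G=\mathbb{R}^d$, the elements $h_1,\dots,h_t$ generate a dense subgroup of $G$, and $f$ is a nonzero complex valued distribution on $\mathbb{R}^d$. \end{enumerate} Let $n_1,\dots,n_t$ be natural numbers (possibly $0$) and $\varphi:G\to\mathbb{C}$ an arbitrary function such that $\Delta_{\varphi;h_k}^{n_k+1}f=0$ for $k=1,\dots,t$. Then $f$ is an exponential monomial, and if $e$ is an exponential to which $f$ corresponds, then $e(h_i)=\varphi(h_i)$ for $i=1,\dots,t$ (so $e$ is unique). If moreover, for some natural number $n$, $\Delta_{\varphi;y}^{n+1}f=0$ for all $y\in G$, then $\varphi=e$; in particular $\varphi$ is an exponential. -/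

import Mathlib

open scoped Distributions

namespace Montel

section Functions

variable {G : Type*} [AddCommGroup G] [TopologicalSpace G]

/-- An exponential on a topological abelian group `G` : a continuous homomorphism of `G` into the
multiplicative group of nonzero complex numbers. -/
def IsExponential (e : G → ℂ) : Prop :=
  Continuous e ∧ (∀ x, e x ≠ 0) ∧ ∀ x y, e (x + y) = e x * e y

/-- A polynomial on `G` : a function `x ↦ P (a₁ x, …, a_k x)`, where `P` is a complex polynomial
in `k` variables and the `a_i` are continuous additive functions `G → ℂ`. -/
def IsPolynomial (p : G → ℂ) : Prop :=
  ∃ (k : ℕ) (P : MvPolynomial (Fin k) ℂ) (a : Fin k → G →ₜ+ ℂ),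
    ∀ x, p x = MvPolynomial.eval (fun i => a i x) P

/-- `f` is an exponential monomial corresponding to the exponential `e`. -/
def IsExpMonomialFor (f e : G → ℂ) : Prop :=
  IsExponential e ∧ ∃ p : G → ℂ, IsPolynomial p ∧ ∀ x, f x = p x * e x

/-- `f` is an exponential monomial : the product of a polynomial and an exponential. -/
def IsExpMonomial (f : G → ℂ) : Prop :=
  ∃ e : G → ℂ, IsExpMonomialFor f e

end Functions

/-- The `φ`-modified difference operator `Δ_{φ;y}` on functions. -/
def modDiff {G : Type*} [AddCommGroup G] (φ : G → ℂ) (y : G) (f : G → ℂ) : G → ℂ :=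
  fun x => f (x + y) - φ y * f x

section Distributions

/-- The space `ℝ^d`. -/
abbrev Rd (d : ℕ) : Type := EuclideanSpace ℝ (Fin d)

variable {d : ℕ}

theorem hasCompactSupport_comp_add_right {g : Rd d → ℝ} (hg : HasCompactSupport g) (y : Rd d) :
    HasCompactSupport (fun x => g (x + y)) :=
  hg.comp_homeomorph (Homeomorph.addRight y)

/-- The translate `x ↦ g (x + y)` of a test function on `ℝ^d`. -/
noncomputable def translateTest (y : Rd d) (g : 𝓓((⊤ : TopologicalSpace.Opens (Rd d)), ℝ)) :
    𝓓((⊤ : TopologicalSpace.Opens (Rd d)), ℝ) where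
  toFun x := g (x + y)
  contDiff' := g.contDiff.comp (contDiff_id.add contDiff_const)
  hasCompactSupport' := hasCompactSupport_comp_add_right g.hasCompactSupport y
  tsupport_subset' := fun _ _ => trivial

/-- The compact set `K - y`. -/
noncomputable def shiftCompact (K : TopologicalSpace.Compacts (Rd d)) (y : Rd d) :
    TopologicalSpace.Compacts (Rd d) :=
  K.map (fun x => x - y) (by fun_prop)

/-- Translation as a continuous linear map on the functions supported in a fixed compact set. -/
noncomputable def translateSupportedIn (y : Rd d) (K : TopologicalSpace.Compacts (Rd d)) :
    𝓓_{K}(Rd d, ℝ) →L[ℝ] 𝓓_{shiftCompact K y}(Rd d, ℝ) :=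
  ContDiffMapSupportedIn.mkCLM ℝ (fun g x => g (x + y))
    (fun _ _ _ => rfl) (fun _ _ _ => rfl)
    (fun g => g.contDiff.comp (contDiff_id.add contDiff_const))
    (fun g x hx => g.zero_on_compl (fun hxy => hx ⟨x + y, hxy, by simp⟩))
    (fun i _ => ⟨{i}, 1, zero_le_one, fun g x _ => by
      rw [iteratedFDeriv_comp_add_right]
      simpa using ContDiffMapSupportedIn.norm_iteratedFDeriv_apply_le_seminorm_top ℝ⟩)

/-- Translation `g ↦ (x ↦ g (x + y))` as a continuous linear map on test functions. -/
noncomputable def translateTestCLM (y : Rd d) :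
    𝓓((⊤ : TopologicalSpace.Opens (Rd d)), ℝ) →L[ℝ]
      𝓓((⊤ : TopologicalSpace.Opens (Rd d)), ℝ) :=
  TestFunction.limitCLM ℝ (translateTest y)
    (fun K _ => TestFunction.ofSupportedInCLM ℝ (fun _ _ => trivial) ∘L translateSupportedIn y K)
    (fun _ _ _ => rfl)

/-- The space of complex valued distributions on `ℝ^d`. -/
abbrev Distr (d : ℕ) : Type := 𝓓'((⊤ : TopologicalSpace.Opens (Rd d)), ℂ)

/-- The translate of a distribution, `(τ_y u)(g) = u (τ_{-y} g)`. -/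
noncomputable def translateDistr (y : Rd d) (u : Distr d) : Distr d :=
  (translateTestCLM (-y)).precompCompactConvergenceCLM ℂ u

theorem translateDistr_apply (y : Rd d) (u : Distr d)
    (g : 𝓓((⊤ : TopologicalSpace.Opens (Rd d)), ℝ)) :
    translateDistr y u g = u (translateTest (-y) g) := rfl

/-- The `φ`-modified difference operator `Δ_{φ;y} = τ_y - φ(y) τ_0` on distributions. -/
noncomputable def modDiffDistr (φ : Rd d → ℂ) (y : Rd d) (u : Distr d) : Distr d :=
  translateDistr y u - φ y • u

/-- The distribution `u` is given by the function `f`, which is required to be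
locally integrable. -/
def IsGivenBy (u : Distr d) (f : Rd d → ℂ) : Prop :=
  MeasureTheory.LocallyIntegrable f ∧
    ∀ g : 𝓓((⊤ : TopologicalSpace.Opens (Rd d)), ℝ), u g = ∫ x, (g x : ℂ) * f x

/-- The distribution `u` is (given by) an exponential monomial corresponding to the
exponential `e`. -/
def IsExpMonomialDistrFor (u : Distr d) (e : Rd d → ℂ) : Prop :=
  ∃ f : Rd d → ℂ, IsExpMonomialFor f e ∧ IsGivenBy u f

/-- The distribution `u` is (given by) an exponential monomial. -/
def IsExpMonomialDistr (u : Distr d) : Prop :=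
  ∃ f : Rd d → ℂ, IsExpMonomial f ∧ IsGivenBy u f

end Distributions

end Montel

/-! Translations commute, and the equations put `f` in a space `W` of continuous functions, the
simultaneous generalised eigenspace of the translations by the h_k with eigenvalues φ(h_k). `W` is
translation invariant. If the φ(h_k) are nonzero it is finite-dimensional: along each h_k the
equation is a recurrence running both ways, so the values on a finite box determine a solution on
the dense subgroup (`finiteDimensional_solSpace`).

A common eigenvector in `W`, normalised, is an exponential `e` with e(h_k) = φ(h_k)
(`exists_isExponential`). Division by `e` makes all eigenvalues 1, and then `G` acts on `W`
unipotently. The logarithm of a unipotent representation is additive and the representation is a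
polynomial in it, so its matrix coefficients, `f / e` among them, are polynomials
(`isPolynomial_matrixCoeff`).

Uniqueness: Δ_{e;y} is nilpotent on `p * e`, and a nonzero vector cannot lie in generalised
eigenspaces for two eigenvalues (`eq_of_diffOp_pow_eq_zero`).

For a distribution, all regularizations lie in `W`, and finite-dimensionality forces the
distribution to be a continuous function (`exists_continuous_isGivenBy`). -/

namespace Montel

/-! ### Translation and difference operators, and their generalised eigenspaces -/

section Functions

variable {G : Type*} [AddCommGroup G]

/-- Translation of functions as a linear operator. -/
def shift (y : G) : Module.End ℂ (G → ℂ) := LinearMap.funLeft ℂ ℂ (· + y)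

@[simp]
theorem shift_apply (y : G) (f : G → ℂ) (x : G) : shift y f x = f (x + y) := rfl

theorem shift_add (x y : G) : shift (x + y) = shift x * shift y := by
  ext f z
  simp [add_assoc, Module.End.mul_apply]

theorem shift_zero : shift (0 : G) = 1 := by
  ext f z
  simp

theorem shift_commute (x y : G) : Commute (shift x) (shift y) := by
  rw [Commute, SemiconjBy, ← shift_add, ← shift_add, add_comm]

/-- The operator `f ↦ f (· + y) - c • f`. -/
def diffOp (c : ℂ) (y : G) : Module.End ℂ (G → ℂ) := shift y - c • 1

@[simp]
theorem diffOp_apply (c : ℂ) (y : G) (f : G → ℂ) (x : G) :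
    diffOp c y f x = f (x + y) - c * f x := rfl

theorem shift_commute_diffOp (c : ℂ) (x y : G) : Commute (shift x) (diffOp c y) :=
  (shift_commute x y).sub_right ((Commute.one_right _).smul_right c)

theorem diffOp_commute (c c' : ℂ) (x y : G) : Commute (diffOp c x) (diffOp c' y) :=
  (shift_commute_diffOp c' x y).sub_left ((Commute.one_left _).smul_left c)

theorem modDiff_iterate (φ : G → ℂ) (y : G) (n : ℕ) (f : G → ℂ) :
    (modDiff φ y)^[n] f = (diffOp (φ y) y ^ n) f := by
  rw [Module.End.pow_apply]
  rfl

theorem fwdDiff_iterate (y : G) (n : ℕ) (f : G → ℂ) :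
    (fwdDiff y)^[n] f = (diffOp 1 y ^ n) f := by
  rw [Module.End.pow_apply]
  congr 2
  ext f x
  simp [fwdDiff]

theorem diffOp_pow_mul {e : G → ℂ} (he : ∀ x y, e (x + y) = e x * e y) (y : G) (n : ℕ)
    (q : G → ℂ) : (diffOp (e y) y ^ n) (q * e) = e y ^ n • ((diffOp 1 y ^ n) q * e) := by
  induction n with
  | zero => simp
  | succ n ih =>
    rw [pow_succ', Module.End.mul_apply, ih, pow_succ' (diffOp 1 y),
      Module.End.mul_apply]
    ext x
    simp [he]
    ring

theorem eq_of_diffOp_pow_eq_zero {f : G → ℂ} (hf : f ≠ 0) {a b : ℂ} {y : G} {m n : ℕ}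
    (ha : (diffOp a y ^ m) f = 0) (hb : (diffOp b y ^ n) f = 0) : a = b := by
  by_contra hab
  refine hf ?_
  have h := Module.End.disjoint_genEigenspace (shift y) hab m n
  refine Submodule.disjoint_def.1 h f ?_ ?_
  · rw [Module.End.mem_genEigenspace_nat]
    exact ha
  · rw [Module.End.mem_genEigenspace_nat]
    exact hb

/-- Along `x + ℤ y` the equation is a linear recurrence of order `n`, solvable backwards too because
`c ≠ 0`. By induction `diffOp c y f` vanishes on the progression, so there `f` is geometric with
ratio `c` and starts at 0. -/
theorem eq_zero_of_diffOp_pow_eq_zero {c : ℂ} (hc : c ≠ 0) (y : G) (n : ℕ) :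
    ∀ (f : G → ℂ) (x : G), (diffOp c y ^ n) f = 0 → (∀ j : ℤ, 0 ≤ j → j < n → f (x + j • y) = 0) →
      ∀ j : ℤ, f (x + j • y) = 0 := by
  induction n with
  | zero =>
    intro f x hf _ j
    rw [pow_zero, Module.End.one_apply] at hf
    rw [hf]
    rfl
  | succ n ih =>
    intro f x hf hx
    have hstep : ∀ j : ℤ, f (x + (j + 1) • y) = c * f (x + j • y) := by
      intro j
      have := ih (diffOp c y f) x (by rwa [← Module.End.mul_apply, ← pow_succ])
        (fun j h0 h1 => by
          rw [diffOp_apply, hx j h0 (by push_cast; omega), add_assoc, ← add_one_zsmul,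
            hx (j + 1) (by omega) (by push_cast; omega)]
          simp) j
      rw [diffOp_apply, add_assoc, ← add_one_zsmul] at this
      exact sub_eq_zero.1 this
    intro j
    induction j with
    | zero => exact hx 0 le_rfl (by positivity)
    | succ i hi => rw [hstep, hi, mul_zero]
    | pred i hi =>
      have := hstep (-i - 1)
      rw [sub_add_cancel, hi] at this
      exact (mul_eq_zero.1 this.symm).resolve_left hc

variable [TopologicalSpace G]

/-- Along a progression `x + j y` the function is a polynomial in `j`, of degree bounded by the
total degree of `P` independently of `x`. -/
theorem IsPolynomial.exists_diffOp_pow_eq_zero {p : G → ℂ} (hp : IsPolynomial p) (y : G) :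
    ∃ n, (diffOp 1 y ^ n) p = 0 := by
  obtain ⟨k, P, a, hP⟩ := hp
  choose Q hQ using fun x : G => show ∃ Q : Polynomial ℂ, Q.natDegree ≤ P.totalDegree ∧
      ∀ j : ℕ, p (x + j • y) = Q.eval (j : ℂ) by
    refine ⟨MvPolynomial.aeval
      (fun i => Polynomial.C (a i x) + Polynomial.C (a i y) * Polynomial.X) P, ?_, fun j => ?_⟩
    · refine (MvPolynomial.aeval_natDegree_le (n := 1) P le_rfl _ fun i => ?_).trans_eq (mul_one _)
      compute_degree
    · rw [hP, ← Polynomial.coe_evalRingHom, MvPolynomial.aeval_def, MvPolynomial.hom_eval₂,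
        MvPolynomial.eval, MvPolynomial.coe_eval₂Hom]
      congr 1
      · ext z
        exact Polynomial.eval_C.symm
      · ext i
        rw [map_add, map_nsmul, nsmul_eq_mul, Polynomial.coe_evalRingHom, Polynomial.eval_add,
          Polynomial.eval_mul, Polynomial.eval_C, Polynomial.eval_C, Polynomial.eval_X, mul_comm]
  refine ⟨P.totalDegree + 1, ?_⟩
  rw [← fwdDiff_iterate]
  ext x
  have h := congrFun (Polynomial.fwdDiff_iter_eq_zero_of_degree_lt
    (P := Q x) (Nat.lt_succ_of_le (hQ x).1)) 0
  rw [fwdDiff_iter_eq_sum_shift] at h ⊢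
  simpa [(hQ x).2] using h

theorem IsExpMonomialFor.apply_eq_of_diffOp_pow_eq_zero {f e : G → ℂ} (hfe : IsExpMonomialFor f e)
    (hf : f ≠ 0) {c : ℂ} {y : G} {m : ℕ} (h : (diffOp c y ^ m) f = 0) : e y = c := by
  obtain ⟨he, p, hp, hfp⟩ := hfe
  obtain ⟨n, hn⟩ := hp.exists_diffOp_pow_eq_zero y
  obtain rfl : f = p * e := funext hfp
  refine eq_of_diffOp_pow_eq_zero hf (n := m) (m := n) ?_ h
  rw [diffOp_pow_mul he.2.2, hn, zero_mul, smul_zero]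

/-! ### Finite-dimensionality of the solution space and existence of the exponential -/

/-- A family of commuting operators, each nilpotent on a nonzero vector of an invariant subspace,
has a common nonzero zero in that subspace. -/
theorem exists_common_kernel {V ι : Type*} [AddCommGroup V] [Module ℂ V] [Finite ι]
    (N : ι → Module.End ℂ V) (hN : ∀ i j, Commute (N i) (N j)) (W : Submodule ℂ V)
    (hW : ∀ i, ∀ v ∈ W, N i v ∈ W) (n : ι → ℕ) {v : V} (hvW : v ∈ W) (hv : v ≠ 0)
    (hnv : ∀ i, (N i ^ n i) v = 0) : ∃ w ∈ W, w ≠ 0 ∧ ∀ i, N i w = 0 := by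
  classical
  have := Fintype.ofFinite ι
  suffices H : ∀ s : Finset ι, ∃ w ∈ W, w ≠ 0 ∧ (∀ i, (N i ^ n i) w = 0) ∧ ∀ i ∈ s, N i w = 0 by
    obtain ⟨w, h1, h2, -, h3⟩ := H Finset.univ
    exact ⟨w, h1, h2, fun i => h3 i (Finset.mem_univ i)⟩
  intro s
  induction s using Finset.induction_on with
  | empty => exact ⟨v, hvW, hv, hnv, by simp⟩
  | insert i s _ ih =>
    obtain ⟨w, hwW, hw, hnw, hsw⟩ := ih
    -- The last nonzero vector among the powers of `N i` applied to `w` is killed by `N i`; by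
    -- commutativity it stays in the kernels already reached.
    have hex : ∃ m, (N i ^ m) w = 0 := ⟨_, hnw i⟩
    have hpos : 0 < Nat.find hex := by
      rw [Nat.find_pos]
      simpa using hw
    obtain ⟨m, hm⟩ := Nat.exists_eq_succ_of_ne_zero hpos.ne'
    have hcomm : ∀ j k, (N j ^ k) ((N i ^ m) w) = (N i ^ m) ((N j ^ k) w) := fun j k => by
      rw [← Module.End.mul_apply, ((hN j i).pow_pow k m).eq, Module.End.mul_apply]
    refine ⟨(N i ^ m) w, ?_, Nat.find_min hex (by omega), fun j => ?_, fun j hj => ?_⟩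
    · clear hm hcomm
      induction m with
      | zero => simpa
      | succ m ihm =>
        rw [pow_succ', Module.End.mul_apply]
        exact hW _ _ ihm
    · rw [hcomm, hnw, map_zero]
    · rcases Finset.mem_insert.1 hj with rfl | hj
      · rw [← Module.End.mul_apply, ← pow_succ', ← Nat.succ_eq_add_one, ← hm]
        exact Nat.find_spec hex
      · have := hcomm j 1
        rwa [pow_one, hsw j hj, map_zero] at this

/-- The space of continuous functions `F` with `Δ_{c k; h k}^{N k} F = 0` for all `k`. -/
def solSpace {ι : Type*} (h : ι → G) (c : ι → ℂ) (N : ι → ℕ) : Submodule ℂ (G → ℂ) where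
  carrier := {f | Continuous f ∧ ∀ k, (diffOp (c k) (h k) ^ N k) f = 0}
  add_mem' := fun hf hg => ⟨hf.1.add hg.1, fun k => by rw [map_add, hf.2, hg.2, add_zero]⟩
  zero_mem' := ⟨continuous_const, fun _ => map_zero _⟩
  smul_mem' := fun a _ hf => ⟨hf.1.const_smul a, fun k => by rw [map_smul, hf.2, smul_zero]⟩

/-- The recurrences release one coordinate at a time from the box, giving zeros at all integer
combinations of the `h k`; continuity and density do the rest. In `key`, `s` is the set of released
coordinates. -/
theorem eq_zero_of_mem_solSpace {t : ℕ} {h : Fin t → G} {c : Fin t → ℂ} (hc : ∀ k, c k ≠ 0)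
    {N : Fin t → ℕ} (hd : Dense (AddSubgroup.closure (Set.range h) : Set G)) {f : G → ℂ}
    (hf : f ∈ solSpace h c N)
    (hbox : ∀ j : (k : Fin t) → Fin (N k), f (∑ k, (j k : ℕ) • h k) = 0) : f = 0 := by
  have key : ∀ s : Finset (Fin t), ∀ j : Fin t → ℤ, (∀ k ∉ s, 0 ≤ j k ∧ j k < N k) →
      f (∑ k, j k • h k) = 0 := by
    intro s
    induction s using Finset.induction_on with
    | empty =>
      intro j hj
      convert hbox fun k => ⟨(j k).toNat, by have := hj k (by simp); omega⟩ using 2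
      refine Finset.sum_congr rfl fun k _ => ?_
      simp only
      rw [← natCast_zsmul, Int.toNat_of_nonneg (hj k (by simp)).1]
    | insert k s hk ih =>
      intro j hj
      have hsum : ∀ i : ℤ, ∑ l, Function.update j k i l • h l =
          (∑ l ∈ Finset.univ.erase k, j l • h l) + i • h k := by
        intro i
        rw [← Finset.sum_erase_add _ _ (Finset.mem_univ k), Function.update_self]
        congr 1
        refine Finset.sum_congr rfl fun l hl => ?_
        rw [Function.update_of_ne (Finset.ne_of_mem_erase hl)]
      have := eq_zero_of_diffOp_pow_eq_zero (hc k) (h k) (N k) f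
        (∑ l ∈ Finset.univ.erase k, j l • h l) (hf.2 k) (fun i h0 h1 => by
          rw [← hsum]
          refine ih _ fun l hl => ?_
          by_cases hlk : l = k
          · subst hlk
            simp [h0, h1]
          · rw [Function.update_of_ne hlk]
            exact hj l (by simp [hlk, hl])) (j k)
      rwa [← hsum, Function.update_eq_self] at this
  have hclosed : IsClosed {y | f y = 0} := isClosed_eq hf.1 continuous_const
  have hsub : (AddSubgroup.closure (Set.range h) : Set G) ⊆ {y | f y = 0} := by
    intro y hy
    rw [SetLike.mem_coe, AddSubgroup.mem_closure_range_iff_of_fintype] at hy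
    obtain ⟨j, rfl⟩ := hy
    exact key Finset.univ j (by simp)
  ext y
  exact (hclosed.closure_subset_iff.2 hsub) (hd y)

theorem finiteDimensional_solSpace {t : ℕ} {h : Fin t → G} {c : Fin t → ℂ} (hc : ∀ k, c k ≠ 0)
    {N : Fin t → ℕ} (hd : Dense (AddSubgroup.closure (Set.range h) : Set G)) :
    FiniteDimensional ℂ (solSpace h c N) := by
  let ev : solSpace h c N →ₗ[ℂ] ((k : Fin t) → Fin (N k)) → ℂ :=
    LinearMap.funLeft ℂ ℂ (fun j => ∑ k, (j k : ℕ) • h k) ∘ₗ (solSpace h c N).subtype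
  refine Module.Finite.of_injective ev ?_
  rw [← LinearMap.ker_eq_bot, LinearMap.ker_eq_bot']
  intro f hf
  exact Subtype.ext (eq_zero_of_mem_solSpace hc hd f.2 fun j => congrFun hf j)

variable [IsTopologicalAddGroup G]

theorem shift_mem_solSpace {ι : Type*} {h : ι → G} {c : ι → ℂ} {N : ι → ℕ} {f : G → ℂ}
    (hf : f ∈ solSpace h c N) (y : G) : shift y f ∈ solSpace h c N := by
  refine ⟨hf.1.comp (continuous_id.add continuous_const), fun k => ?_⟩
  rw [← Module.End.mul_apply, ← ((shift_commute_diffOp (c k) y (h k)).pow_right (N k)).eq,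
    Module.End.mul_apply, hf.2, map_zero]

theorem diffOp_mem_solSpace {ι : Type*} {h : ι → G} {c : ι → ℂ} {N : ι → ℕ} {f : G → ℂ}
    (hf : f ∈ solSpace h c N) (b : ℂ) (y : G) : diffOp b y f ∈ solSpace h c N :=
  Submodule.sub_mem _ (shift_mem_solSpace hf y) (Submodule.smul_mem _ b hf)

/-- A common eigenvector `F` of the translations by the `h k` is an eigenvector for the whole
subgroup. Clearing the eigenvalue gives the closed condition `hmul`, which density extends to `G`;
then `F (x₀ + ·) / F x₀` is multiplicative. -/
theorem exists_isExponential {ι : Type*} [Finite ι] {h : ι → G} {c : ι → ℂ} {N : ι → ℕ}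
    (hd : Dense (AddSubgroup.closure (Set.range h) : Set G)) {f : G → ℂ}
    (hf : f ∈ solSpace h c N) (hf0 : f ≠ 0) :
    ∃ e : G → ℂ, IsExponential e ∧ ∀ k, e (h k) = c k := by
  obtain ⟨F, hFW, hF0, hF⟩ := exists_common_kernel (fun k => diffOp (c k) (h k))
    (fun i j => diffOp_commute _ _ _ _) (solSpace h c N)
    (fun i v hv => diffOp_mem_solSpace hv _ _) N hf hf0 hf.2
  have hFc : Continuous F := hFW.1
  obtain ⟨x₀, hx₀⟩ := Function.ne_iff.1 hF0
  simp only [Pi.zero_apply] at hx₀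
  have hFh : ∀ k x, F (x + h k) = c k * F x := fun k x => sub_eq_zero.1 (congrFun (hF k) x)
  have key : ∀ y ∈ AddSubgroup.closure (Set.range h), ∃ b : ℂ, ∀ x, F (x + y) = b * F x := by
    intro y hy
    induction hy using AddSubgroup.closure_induction with
    | mem y hy =>
      obtain ⟨k, rfl⟩ := hy
      exact ⟨c k, hFh k⟩
    | zero => exact ⟨1, by simp⟩
    | add y z _ _ ihy ihz =>
      obtain ⟨b, hb⟩ := ihy
      obtain ⟨b', hb'⟩ := ihz
      exact ⟨b' * b, fun x => by rw [← add_assoc, hb', hb, mul_assoc]⟩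
    | neg y _ ih =>
      obtain ⟨b, hb⟩ := ih
      have hb0 : b ≠ 0 := by
        rintro rfl
        have := hb (x₀ - y)
        rw [sub_add_cancel, zero_mul] at this
        exact hx₀ this
      refine ⟨b⁻¹, fun x => ?_⟩
      have := hb (x + -y)
      rw [neg_add_cancel_right] at this
      rw [this, inv_mul_cancel_left₀ hb0]
  have hmul : ∀ x y, F (x + y) * F x₀ = F x * F (x₀ + y) := by
    intro x
    have hclosed : IsClosed {y | F (x + y) * F x₀ = F x * F (x₀ + y)} :=
      isClosed_eq (by fun_prop) (by fun_prop)
    have hsub : (AddSubgroup.closure (Set.range h) : Set G) ⊆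
        {y | F (x + y) * F x₀ = F x * F (x₀ + y)} := by
      intro y hy
      obtain ⟨b, hb⟩ := key y hy
      simp only [Set.mem_ofPred_eq, hb]
      ring
    intro y
    exact (hclosed.closure_subset_iff.2 hsub) (hd y)
  have hadd : ∀ x y, F (x₀ + (x + y)) / F x₀ = F (x₀ + x) / F x₀ * (F (x₀ + y) / F x₀) := by
    intro x y
    rw [div_mul_div_comm, div_eq_div_iff hx₀ (mul_ne_zero hx₀ hx₀), ← add_assoc, ← mul_assoc, hmul]
  refine ⟨fun y => F (x₀ + y) / F x₀, ⟨by fun_prop, fun y (hy : F (x₀ + y) / F x₀ = 0) => ?_, hadd⟩, fun k => ?_⟩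
  · have := hadd y (-y)
    rw [hy, zero_mul, add_neg_cancel, add_zero, div_self hx₀] at this
    exact one_ne_zero this
  · simp only
    rw [hFh, mul_div_cancel_right₀ _ hx₀]

end Functions

/-- A family of linear functionals on a finite-dimensional space which separates points spans the
dual space. -/
theorem span_dual_eq_top {V : Type*} [AddCommGroup V] [Module ℂ V] [FiniteDimensional ℂ V]
    {S : Set (Module.Dual ℂ V)} (hS : ∀ v, (∀ l ∈ S, l v = 0) → v = 0) :
    Submodule.span ℂ S = ⊤ := by
  rw [← Subspace.dualCoannihilator_dualAnnihilator_eq (W := Submodule.span ℂ S)]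
  suffices h : (Submodule.span ℂ S).dualCoannihilator = ⊥ by
    rw [h, Submodule.dualAnnihilator_bot]
  rw [eq_bot_iff]
  intro v hv
  rw [Submodule.mem_dualCoannihilator] at hv
  exact hS v fun l hl => hv l (Submodule.subset_span hl)

/-! ### The logarithm of a unipotent element -/

section Unipotent

open Polynomial

/-- The binomial polynomial `X (X - 1) ⋯ (X - j + 1) / j!`. -/
noncomputable def binomPoly (j : ℕ) : ℂ[X] := C ((j.factorial : ℂ)⁻¹) * descPochhammer ℂ j

theorem binomPoly_eval (j k : ℕ) : (binomPoly j).eval (k : ℂ) = k.choose j := by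
  rw [binomPoly, eval_mul, eval_C, descPochhammer_eval_eq_descFactorial,
    Nat.descFactorial_eq_factorial_mul_choose, Nat.cast_mul,
    inv_mul_cancel_left₀ (Nat.cast_ne_zero.2 j.factorial_ne_zero)]

theorem binomPoly_natDegree_le (j : ℕ) : (binomPoly j).natDegree ≤ j :=
  (natDegree_C_mul_le _ _).trans (descPochhammer_natDegree ℂ j).le

variable {R : Type*} [CommRing R] [Algebra ℂ R]

/-- `R` may have zero divisors, so roots are counted over ℂ, after applying a linear functional to
the coefficients. -/
theorem polynomial_eq_zero_of_eval_nat {P : R[X]} (hP : ∀ k : ℕ, P.eval (k : R) = 0) : P = 0 := by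
  ext i
  rw [coeff_zero, ← Module.forall_dual_apply_eq_zero_iff ℂ]
  intro l
  let Q : ℂ[X] := ∑ m ∈ Finset.range (P.natDegree + 1), C (l (P.coeff m)) * X ^ m
  have hQ : Q = 0 := by
    refine Polynomial.eq_zero_of_infinite_isRoot Q
      ((Set.infinite_range_of_injective (Nat.cast_injective (R := ℂ))).mono ?_)
    rintro _ ⟨k, rfl⟩
    have h : l (P.eval (k : R)) = 0 := by rw [hP, map_zero]
    rw [eval_eq_sum_range, map_sum] at h
    simp only [Set.mem_ofPred_eq, IsRoot.def, Q, eval_finsetSum, eval_mul, eval_C, eval_pow, eval_X]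
    rw [← h]
    refine Finset.sum_congr rfl fun m _ => ?_
    rw [mul_comm (P.coeff m), ← Nat.cast_pow, ← Nat.cast_pow, ← nsmul_eq_mul, map_nsmul,
      nsmul_eq_mul, mul_comm]
  by_cases hi : i ≤ P.natDegree
  · have h : Q.coeff i = 0 := by rw [hQ, coeff_zero]
    simp only [Q, finsetSum_coeff, coeff_C_mul, coeff_X_pow] at h
    simpa [Nat.lt_succ_iff, hi] using h
  · rw [coeff_eq_zero_of_natDegree_lt (not_le.1 hi), map_zero]

/-- The polynomial `∑ j < D, (X choose j) • u ^ j`, which interpolates the powers of `1 + u` when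
`u ^ D = 0`. -/
noncomputable def powPoly (D : ℕ) (u : R) : R[X] :=
  ∑ j ∈ Finset.range D, (binomPoly j).map (algebraMap ℂ R) * C (u ^ j)

theorem powPoly_eval {D : ℕ} {u : R} (hu : u ^ D = 0) (k : ℕ) :
    (powPoly D u).eval (k : R) = (u + 1) ^ k := by
  have h : ∀ j, ((binomPoly j).map (algebraMap ℂ R)).eval (k : R) = k.choose j := fun j => by
    rw [← map_natCast (algebraMap ℂ R) k, eval_map_apply, binomPoly_eval, map_natCast]
  simp only [powPoly, eval_finsetSum, eval_mul, eval_C, h]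
  rw [add_pow]
  simp only [one_pow, mul_one, mul_comm (_ : R) (u ^ _)]
  -- Terms with `j ≥ D` vanish by nilpotency and those with `j > k` by the binomial coefficient, so
  -- both sums extend to a common range.
  have h1 : ∀ n, D ≤ n → ∑ j ∈ Finset.range D, u ^ j * (k.choose j : R) =
      ∑ j ∈ Finset.range n, u ^ j * (k.choose j : R) := fun n hn =>
    Finset.sum_subset (Finset.range_mono hn) fun j _ hj => by
      rw [pow_eq_zero_of_le (by simpa using hj) hu, zero_mul]
  rw [h1 (max D (k + 1)) (le_max_left _ _)]
  refine (Finset.sum_subset (Finset.range_mono (le_max_right _ _)) fun j _ hj => ?_).symm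
  rw [Nat.choose_eq_zero_of_lt (by simpa using hj), Nat.cast_zero, mul_zero]

theorem powPoly_natDegree_le (D : ℕ) (u : R) : (powPoly D u).natDegree ≤ D := by
  refine natDegree_sum_le_of_forall_le _ _ fun j hj => ?_
  refine natDegree_mul_le.trans ?_
  rw [natDegree_C, add_zero]
  exact (natDegree_map_le.trans (binomPoly_natDegree_le j)).trans (Finset.mem_range.1 hj).le

theorem powPoly_coeff_zero {D : ℕ} {u : R} (hu : u ^ D = 0) : (powPoly D u).coeff 0 = 1 := by
  rw [coeff_zero_eq_eval_zero, ← Nat.cast_zero, powPoly_eval hu, pow_zero]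

theorem powPoly_mul {D : ℕ} {u v : R} (hu : u ^ D = 0) (hv : v ^ D = 0)
    (huv : ((u + 1) * (v + 1) - 1) ^ D = 0) :
    powPoly D ((u + 1) * (v + 1) - 1) = powPoly D u * powPoly D v := by
  rw [← sub_eq_zero]
  refine polynomial_eq_zero_of_eval_nat fun k => ?_
  rw [eval_sub, eval_mul, powPoly_eval hu, powPoly_eval hv, powPoly_eval huv, sub_add_cancel,
    mul_pow, sub_self]

/-- The logarithm of `1 + u` when `u ^ D = 0`. -/
noncomputable def unipLog (D : ℕ) (u : R) : R := (powPoly D u).coeff 1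

theorem unipLog_eq_sum (D : ℕ) (u : R) :
    unipLog D u = ∑ j ∈ Finset.range D, (binomPoly j).coeff 1 • u ^ j := by
  simp only [unipLog, powPoly, finsetSum_coeff, coeff_mul_C, coeff_map, Algebra.smul_def]

theorem unipLog_mul {D : ℕ} {u v : R} (hu : u ^ D = 0) (hv : v ^ D = 0)
    (huv : ((u + 1) * (v + 1) - 1) ^ D = 0) :
    unipLog D ((u + 1) * (v + 1) - 1) = unipLog D u + unipLog D v := by
  rw [unipLog, powPoly_mul hu hv huv, mul_coeff_one, powPoly_coeff_zero hu, powPoly_coeff_zero hv,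
    one_mul, mul_one, add_comm]
  rfl

/-- The values at naturals satisfy q(k + m) = q(k) q(m), hence so does the Taylor shift of `q` at
`k`; its coefficient of degree 1 is q'(k). -/
theorem powPoly_derivative {D : ℕ} {u : R} (hu : u ^ D = 0) :
    derivative (powPoly D u) = C (unipLog D u) * powPoly D u := by
  rw [← sub_eq_zero]
  refine polynomial_eq_zero_of_eval_nat fun k => ?_
  have h : taylor (k : R) (powPoly D u) = C ((powPoly D u).eval (k : R)) * powPoly D u := by
    rw [← sub_eq_zero]
    refine polynomial_eq_zero_of_eval_nat fun m => ?_
    rw [eval_sub, taylor_eval, eval_mul, eval_C, ← Nat.cast_add, powPoly_eval hu, powPoly_eval hu,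
      powPoly_eval hu, pow_add, mul_comm, sub_self]
  have h1 := congrArg (fun P => coeff P 1) h
  simp only [taylor_coeff_one, coeff_C_mul] at h1
  rw [eval_sub, h1, eval_mul, eval_C, unipLog, mul_comm, sub_self]

/-- The differential equation q' = (log) q with q(0) = 1 forces the exponential series. -/
theorem powPoly_coeff {D : ℕ} {u : R} (hu : u ^ D = 0) (k : ℕ) :
    (powPoly D u).coeff k = (k.factorial : ℂ)⁻¹ • unipLog D u ^ k := by
  induction k with
  | zero => simp [powPoly_coeff_zero hu]
  | succ k ih =>
    have h := congrArg (fun P => coeff P k) (powPoly_derivative hu)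
    simp only [coeff_derivative, coeff_C_mul, ih] at h
    have hk : ((k : ℂ) + 1) ≠ 0 := Nat.cast_add_one_ne_zero k
    have h2 : ((k : ℂ) + 1) • (powPoly D u).coeff (k + 1) =
        (k.factorial : ℂ)⁻¹ • unipLog D u ^ (k + 1) := by
      rw [Algebra.smul_def, map_add, map_natCast, map_one, mul_comm, h, pow_succ', mul_smul_comm]
    rw [← inv_smul_smul₀ hk ((powPoly D u).coeff (k + 1)), h2, smul_smul, Nat.factorial_succ,
      Nat.cast_mul, mul_inv, Nat.cast_add_one]

theorem one_add_eq_sum_unipLog {D : ℕ} {u : R} (hu : u ^ D = 0) :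
    u + 1 = ∑ k ∈ Finset.range (D + 1), (k.factorial : ℂ)⁻¹ • unipLog D u ^ k := by
  have h := powPoly_eval hu 1
  rw [pow_one, eval_eq_sum_range' (Nat.lt_succ_of_le (powPoly_natDegree_le D u))] at h
  rw [← h]
  exact Finset.sum_congr rfl fun k _ => by simp [powPoly_coeff hu]

end Unipotent

/-! ### Unipotent representations have polynomial coefficients -/

/-- A unipotent representation of `G` in a finite-dimensional commutative algebra has polynomial
coefficients. -/
theorem isPolynomial_dual_apply {G R : Type*} [AddCommGroup G] [TopologicalSpace G]
    [IsTopologicalAddGroup G] [CommRing R] [Algebra ℂ R] [FiniteDimensional ℂ R] (χ : G → R)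
    (hχ : ∀ x y, χ (x + y) = χ x * χ y) (hχ0 : χ 0 = 1) {D : ℕ} (hD : ∀ x, (χ x - 1) ^ D = 0)
    (hc : ∀ l : Module.Dual ℂ R, Continuous fun x => l (χ x)) (l : Module.Dual ℂ R) :
    IsPolynomial fun x => l (χ x) := by
  have hnat : ∀ (n : ℕ) x, χ (n • x) = χ x ^ n := fun n x => by
    induction n with
    | zero => simp [hχ0]
    | succ n ih => rw [succ_nsmul, hχ, ih, pow_succ]
  -- Since `χ x ^ m = χ (m • x)`, each term of the binomial expansion is a linear functional of `χ`
  -- at a multiple of `x`.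
  have hpow : ∀ (n : ℕ) (l : Module.Dual ℂ R), Continuous fun x => l ((χ x - 1) ^ n) := by
    intro n l
    simp only [sub_eq_add_neg, add_pow, map_sum]
    refine continuous_finsetSum _ fun m _ => ?_
    have := (hc (l ∘ₗ LinearMap.mulRight ℂ ((-1) ^ (n - m) * (n.choose m : R)))).comp
      (continuous_nsmul m)
    simpa [Function.comp_def, hnat, mul_assoc] using this
  let L : G → R := fun x => unipLog D (χ x - 1)
  have hLadd : ∀ x y, L (x + y) = L x + L y := by
    intro x y
    have := unipLog_mul (hD x) (hD y) (by simpa [← hχ] using hD (x + y))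
    simpa [L, hχ] using this
  have hLc : ∀ l : Module.Dual ℂ R, Continuous fun x => l (L x) := by
    intro l
    simp only [L, unipLog_eq_sum, map_sum, map_smul, smul_eq_mul]
    exact continuous_finsetSum _ fun m _ => continuous_const.mul (hpow m l)
  have hχL : ∀ x, χ x = ∑ k ∈ Finset.range (D + 1), (k.factorial : ℂ)⁻¹ • L x ^ k := fun x => by
    have := one_add_eq_sum_unipLog (hD x)
    rwa [sub_add_cancel] at this
  let b := Module.finBasis ℂ R
  let a : Fin (Module.finrank ℂ R) → G →ₜ+ ℂ := fun i =>
    { toFun := fun x => b.coord i (L x)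
      map_zero' := by
        have : L 0 = 0 := by simpa using hLadd 0 0
        rw [this, map_zero]
      map_add' := fun x y => by rw [hLadd, map_add]
      continuous_toFun := hLc _ }
  -- The truncated exponential of the generic vector `∑ b i X_i`; at the coordinates of `L x` it
  -- takes the value `χ x`.
  let Q : MvPolynomial (Fin (Module.finrank ℂ R)) R := ∑ k ∈ Finset.range (D + 1),
    MvPolynomial.C (algebraMap ℂ R (k.factorial : ℂ)⁻¹) *
      (∑ i, MvPolynomial.C (b i) * MvPolynomial.X i) ^ k
  have hQ : ∀ x, MvPolynomial.eval (fun i => algebraMap ℂ R (a i x)) Q = χ x := by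
    intro x
    have hLx : ∑ i, b i * algebraMap ℂ R (a i x) = L x := by
      conv_rhs => rw [← b.sum_repr (L x)]
      exact Finset.sum_congr rfl fun i _ => by rw [Algebra.smul_def, mul_comm]; rfl
    rw [hχL]
    simp only [Q, map_sum, map_mul, map_pow, MvPolynomial.eval_C, MvPolynomial.eval_X, hLx,
      Algebra.smul_def]
  -- The evaluation points are complex scalars, so `l` may be applied coefficient by coefficient.
  refine ⟨_, ∑ s ∈ Q.support, MvPolynomial.monomial s (l (Q.coeff s)), a, fun x => ?_⟩
  simp only
  rw [← hQ, MvPolynomial.eval_eq, map_sum, map_sum]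
  refine Finset.sum_congr rfl fun s _ => ?_
  rw [MvPolynomial.eval_monomial, Finsupp.prod]
  simp only [← map_pow, ← map_prod]
  rw [mul_comm (Q.coeff s), ← Algebra.smul_def, map_smul, smul_eq_mul, mul_comm]

/-- Unipotent commuting operators form a group. -/
theorem isNilpotent_sub_one_of_mem_closure {G A : Type*} [AddCommGroup G] [Ring A] (T : G → A)
    (hT : ∀ x y, T (x + y) = T x * T y) (hT0 : T 0 = 1) {S : Set G}
    (hS : ∀ y ∈ S, IsNilpotent (T y - 1)) {y : G} (hy : y ∈ AddSubgroup.closure S) :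
    IsNilpotent (T y - 1) := by
  have hcomm : ∀ x y, Commute (T x) (T y) := fun x y => by
    rw [Commute, SemiconjBy, ← hT, ← hT, add_comm]
  induction hy using AddSubgroup.closure_induction with
  | mem y hy => exact hS y hy
  | zero => rw [hT0, sub_self]; exact IsNilpotent.zero
  | add y z _ _ ihy ihz =>
    have : T (y + z) - 1 = T y * (T z - 1) + (T y - 1) := by rw [hT]; noncomm_ring
    rw [this]
    have hc : Commute (T y) (T z - 1) := (hcomm y z).sub_right (Commute.one_right _)
    refine Commute.isNilpotent_add ?_ (hc.isNilpotent_mul_left ihz) ihy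
    refine Commute.sub_right ?_ (Commute.one_right _)
    exact (Commute.refl _).mul_left ((hcomm z y).sub_left (Commute.one_left _))
  | neg y _ ih =>
    have : T (-y) - 1 = -(T (-y) * (T y - 1)) := by
      rw [mul_sub, ← hT, neg_add_cancel, hT0, mul_one, neg_sub]
    rw [this]
    have hc : Commute (T (-y)) (T y - 1) := (hcomm _ _).sub_right (Commute.one_right _)
    exact (hc.isNilpotent_mul_left ih).neg

open scoped IsMulCommutative in
/-- The matrix coefficients of a unipotent representation on a finite-dimensional space are
polynomials, if enough of them are continuous. -/
theorem isPolynomial_matrixCoeff {G V : Type*} [AddCommGroup G] [TopologicalSpace G]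
    [IsTopologicalAddGroup G] [AddCommGroup V] [Module ℂ V] [FiniteDimensional ℂ V]
    (T : G → Module.End ℂ V) (hT : ∀ x y, T (x + y) = T x * T y) (hT0 : T 0 = 1) {D : ℕ}
    (hD : ∀ x, (T x - 1) ^ D = 0) {S : Set (Module.Dual ℂ V)}
    (hS : ∀ v, (∀ l ∈ S, l v = 0) → v = 0) (hc : ∀ l ∈ S, ∀ v, Continuous fun x => l (T x v))
    (l : Module.Dual ℂ V) (v : V) : IsPolynomial fun x => l (T x v) := by
  have hcomm : ∀ a ∈ Set.range T, ∀ b ∈ Set.range T, a * b = b * a := by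
    rintro _ ⟨x, rfl⟩ _ ⟨y, rfl⟩
    rw [← hT, ← hT, add_comm]
  let A : Subalgebra ℂ (Module.End ℂ V) := Algebra.adjoin ℂ (Set.range T)
  have : IsMulCommutative A := Algebra.isMulCommutative_adjoin ℂ hcomm
  have : FiniteDimensional ℂ A :=
    inferInstanceAs (FiniteDimensional ℂ (Subalgebra.toSubmodule A))
  let χ : G → A := fun x => ⟨T x, Algebra.subset_adjoin ⟨x, rfl⟩⟩
  let coeff : Module.Dual ℂ V → V → Module.Dual ℂ A := fun l v =>
    l ∘ₗ LinearMap.applyₗ v ∘ₗ A.val.toLinearMap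
  -- The functionals `a ↦ l (a v)` with `l ∈ S` separate the points of `A`, hence span its dual;
  -- continuity thus passes from `S` to every functional on `A`.
  have hspan : Submodule.span ℂ (Set.image2 coeff S Set.univ) = ⊤ := by
    refine span_dual_eq_top fun r hr => Subtype.ext (LinearMap.ext fun v => hS _ fun l hl => ?_)
    exact hr _ ⟨l, hl, v, trivial, rfl⟩
  have hcont : ∀ l : Module.Dual ℂ A, Continuous fun x => l (χ x) := by
    intro l
    have hl : l ∈ Submodule.span ℂ (Set.image2 coeff S Set.univ) := hspan ▸ trivial
    induction hl using Submodule.span_induction with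
    | mem l hl =>
      obtain ⟨l, hl, v, -, rfl⟩ := hl
      exact hc l hl v
    | zero => exact continuous_const
    | add l l' _ _ ih ih' => exact ih.add ih'
    | smul a l _ ih => exact ih.const_smul a
  exact isPolynomial_dual_apply χ (fun x y => Subtype.ext (hT x y)) (Subtype.ext hT0)
    (fun x => Subtype.ext (hD x)) hcont (coeff l v)

/-! ### Classification of continuous solutions -/

section Functions

variable {G : Type*} [AddCommGroup G] [TopologicalSpace G] [IsTopologicalAddGroup G]

/-- `p x` is the matrix coefficient of the translation representation on the solution space given by
`p` and evaluation at 0. -/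
theorem isPolynomial_of_mem_solSpace {t : ℕ} {h : Fin t → G} {N : Fin t → ℕ}
    (hd : Dense (AddSubgroup.closure (Set.range h) : Set G)) {p : G → ℂ}
    (hp : p ∈ solSpace h 1 N) : IsPolynomial p := by
  have : FiniteDimensional ℂ (solSpace h 1 N) := finiteDimensional_solSpace (by simp) hd
  let T : G → Module.End ℂ (solSpace h 1 N) := fun y =>
    (shift y).restrict fun f hf => shift_mem_solSpace hf y
  have hT : ∀ x y, T (x + y) = T x * T y := fun x y => by
    ext f z
    exact congrArg (f : G → ℂ) (add_assoc z x y).symm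
  have hT0 : T 0 = 1 := by
    ext f z
    exact congrArg (f : G → ℂ) (add_zero z)
  have hTpow : ∀ (n : ℕ) (y : G) (f : solSpace h 1 N), (((T y - 1) ^ n) f : G → ℂ) =
      (diffOp 1 y ^ n) (f : G → ℂ) := by
    intro n y f
    induction n with
    | zero => rfl
    | succ n ih =>
      rw [pow_succ', Module.End.mul_apply, pow_succ', Module.End.mul_apply, ← ih]
      ext x
      rw [diffOp_apply, one_mul]
      rfl
  have hnil : ∀ y ∈ AddSubgroup.closure (Set.range h), IsNilpotent (T y - 1) := by
    refine fun y => isNilpotent_sub_one_of_mem_closure T hT hT0 ?_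
    rintro _ ⟨k, rfl⟩
    exact ⟨N k, LinearMap.ext fun f => Subtype.ext ((hTpow _ _ _).trans (f.2.2 k))⟩
  -- The nilpotency exponent varies over the subgroup, but the dimension bounds it uniformly; only
  -- then is unipotency a closed condition that density extends to `G`.
  have hD : ∀ y, (T y - 1) ^ Module.finrank ℂ (solSpace h 1 N) = 0 := by
    intro y
    refine LinearMap.ext fun f => Subtype.ext (funext fun x => ?_)
    rw [hTpow, ← fwdDiff_iterate]
    have hclosed : IsClosed
        {y | (fwdDiff y)^[Module.finrank ℂ (solSpace h 1 N)] (f : G → ℂ) x = 0} := by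
      have hf : Continuous (f : G → ℂ) := f.2.1
      simp only [fwdDiff_iter_eq_sum_shift]
      exact isClosed_eq (by fun_prop) continuous_const
    refine (hclosed.closure_subset_iff.2 fun y hy => ?_) (hd y)
    obtain ⟨n, hn⟩ := hnil y hy
    have hker := Module.End.ker_pow_le_ker_pow_finrank (T y - 1) n
    have : ((T y - 1) ^ Module.finrank ℂ (solSpace h 1 N)) f = 0 :=
      hker (by rw [LinearMap.mem_ker, hn, LinearMap.zero_apply])
    rw [Set.mem_ofPred_eq, fwdDiff_iterate, ← hTpow, this]
    rfl
  let ev : G → Module.Dual ℂ (solSpace h 1 N) := fun z =>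
    LinearMap.proj z ∘ₗ (solSpace h 1 N).subtype
  have key := isPolynomial_matrixCoeff T hT hT0 hD (S := Set.range ev)
    (fun f hf => Subtype.ext (funext fun z => hf _ ⟨z, rfl⟩))
    (by
      rintro _ ⟨z, rfl⟩ f
      exact f.2.1.comp (continuous_const.add continuous_id))
    (ev 0) ⟨p, hp⟩
  convert key using 2 with x
  exact congrArg p (zero_add x).symm

theorem isExpMonomial_of_mem_solSpace {t : ℕ} {h : Fin t → G} {c : Fin t → ℂ} {N : Fin t → ℕ}
    (hd : Dense (AddSubgroup.closure (Set.range h) : Set G)) {f : G → ℂ}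
    (hf : f ∈ solSpace h c N) (hf0 : f ≠ 0) : IsExpMonomial f := by
  obtain ⟨e, he, hec⟩ := exists_isExponential hd hf hf0
  have hfe : f = (f * e⁻¹) * e := by
    ext x
    exact (inv_mul_cancel_right₀ (he.2.1 x) (f x)).symm
  refine ⟨e, he, f * e⁻¹, isPolynomial_of_mem_solSpace hd (N := N)
    ⟨hf.1.mul (he.1.inv₀ he.2.1), fun k => ?_⟩, congrFun hfe⟩
  have h0 := hf.2 k
  rw [hfe, ← hec k, diffOp_pow_mul he.2.2] at h0
  ext x
  have hx := congrFun h0 x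
  simp only [Pi.smul_apply, Pi.mul_apply, smul_eq_mul, Pi.zero_apply, mul_eq_zero,
    he.2.1 x, or_false] at hx
  exact hx.resolve_left (pow_ne_zero _ (he.2.1 _))

/-- The classification of the continuous solutions of `Δ_{φ; h k} ^ (n k + 1) f = 0`. -/
theorem isExpMonomial_and_unique {t : ℕ} {n : Fin t → ℕ} {h : Fin t → G} {f φ : G → ℂ}
    (hd : Dense (AddSubgroup.closure (Set.range h) : Set G)) (hfc : Continuous f) (hf0 : f ≠ 0)
    (hf : ∀ k, (modDiff φ (h k))^[n k + 1] f = 0) :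
    IsExpMonomial f ∧ ∀ e : G → ℂ, IsExpMonomialFor f e → (∀ i, e (h i) = φ (h i)) ∧
      ∀ m : ℕ, (∀ y, (modDiff φ y)^[m + 1] f = 0) → φ = e ∧ IsExponential φ := by
  simp only [modDiff_iterate] at hf ⊢
  refine ⟨isExpMonomial_of_mem_solSpace hd (c := fun k => φ (h k)) (N := fun k => n k + 1)
    ⟨hfc, hf⟩ hf0, fun e hfe => ⟨fun i => hfe.apply_eq_of_diffOp_pow_eq_zero hf0 (hf i),
    fun m hm => ?_⟩⟩
  obtain rfl : e = φ := funext fun y => hfe.apply_eq_of_diffOp_pow_eq_zero hf0 (hm y)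
  exact ⟨rfl, hfe.1⟩

end Functions

/-! ### Distributions as functionals of finitely many derivatives -/

open MeasureTheory Set
open scoped BoundedContinuousFunction Convolution Pointwise

/-- A linear functional which is bounded in terms of a linear map into a normed space factors
continuously through it. -/
theorem exists_continuousLinearMap_comp_eq {V B : Type*} [AddCommGroup V] [Module ℝ V]
    [NormedAddCommGroup B] [NormedSpace ℝ B] (u : V →ₗ[ℝ] ℂ) (J : V →ₗ[ℝ] B) (C : ℝ)
    (h : ∀ v, ‖u v‖ ≤ C * ‖J v‖) : ∃ U : B →L[ℝ] ℂ, ∀ v, U (J v) = u v := by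
  -- The bound makes `u` vanish on the kernel of `J`, so `u ∘ s` does not depend on the section `s`;
  -- it is then extended from the range of `J` to `B`.
  obtain ⟨s, hs⟩ := J.rangeRestrict.exists_rightInverse_of_surjective J.range_rangeRestrict
  have hJs : ∀ b : LinearMap.range J, J (s b) = b := fun b =>
    congrArg Subtype.val (LinearMap.congr_fun hs b)
  have hker : ∀ v, J v = 0 → u v = 0 := fun v hv => by
    simpa [hv] using h v
  let f : LinearMap.range J →L[ℝ] ℂ := (u ∘ₗ s).mkContinuous C fun b => by
    simpa [hJs] using h (s b)
  obtain ⟨U, hU⟩ := f.exist_extension_of_finiteDimensional_range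
  refine ⟨U, fun v => ?_⟩
  have h1 := DFunLike.congr_fun hU ⟨J v, v, rfl⟩
  refine h1.symm.trans (sub_eq_zero.1 ?_)
  change u (s ⟨J v, v, rfl⟩) - u v = 0
  rw [← map_sub]
  exact hker _ (by rw [map_sub, hJs, sub_self])

variable {d : ℕ}

/-- The space of test functions on `ℝ^d`. -/
abbrev Test (d : ℕ) : Type := 𝓓((⊤ : TopologicalSpace.Opens (Rd d)), ℝ)

@[simp]
theorem translateTest_apply (y : Rd d) (g : Test d) (x : Rd d) :
    translateTest y g x = g (x + y) := rfl

theorem translateTest_translateTest (x y : Rd d) (g : Test d) :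
    translateTest x (translateTest y g) = translateTest (x + y) g :=
  TestFunction.ext fun z => by simp [add_assoc]

/-- The normed space of `i`-linear forms on `ℝ^d`. -/
def FormSpace (d i : ℕ) : Type := Rd d [×i]→L[ℝ] ℝ

noncomputable instance (i : ℕ) : NormedAddCommGroup (FormSpace d i) :=
  inferInstanceAs (NormedAddCommGroup (Rd d [×i]→L[ℝ] ℝ))

noncomputable instance (i : ℕ) : NormedSpace ℝ (FormSpace d i) :=
  inferInstanceAs (NormedSpace ℝ (Rd d [×i]→L[ℝ] ℝ))

instance (i : ℕ) : CompleteSpace (FormSpace d i) :=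
  inferInstanceAs (CompleteSpace (Rd d [×i]→L[ℝ] ℝ))

/-- The `i`-th derivative of a function. -/
noncomputable def iterD (i : ℕ) (f : Rd d → ℝ) : Rd d → FormSpace d i := iteratedFDeriv ℝ i f

/-- Constants as `0`-linear forms. -/
noncomputable def formZeroEquiv (d : ℕ) : ℝ ≃L[ℝ] FormSpace d 0 :=
  (continuousMultilinearCurryFin0 ℝ (Rd d) ℝ).symm.toContinuousLinearEquiv

/-- Uncurrying of linear maps into a space of forms. -/
noncomputable def formSuccEquiv (d i : ℕ) : (Rd d →L[ℝ] FormSpace d i) ≃L[ℝ] FormSpace d (i + 1) :=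
  (continuousMultilinearCurryLeftEquiv ℝ
    (fun _ : Fin (i + 1) => Rd d) ℝ).symm.toContinuousLinearEquiv

theorem iterD_zero (f : Rd d → ℝ) (x : Rd d) : iterD 0 f x = formZeroEquiv d (f x) := rfl

theorem iterD_succ (i : ℕ) (f : Rd d → ℝ) (x : Rd d) :
    iterD (i + 1) f x = formSuccEquiv d i (fderiv ℝ (iterD i f) x) := rfl

theorem iterD_comp_add_right (i : ℕ) (f : Rd d → ℝ) (y x : Rd d) :
    iterD i (fun z => f (z + y)) x = iterD i f (x + y) :=
  iteratedFDeriv_comp_add_right i y x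

theorem Test.contDiff_iterD (g : Test d) (i : ℕ) : ContDiff ℝ 1 (iterD i g) :=
  g.contDiff.iteratedFDeriv_right (m := 1) (i := i) (by exact_mod_cast le_top)

theorem Test.hasCompactSupport_iterD (g : Test d) (i : ℕ) : HasCompactSupport (iterD i g) :=
  g.hasCompactSupport.iteratedFDeriv i

/-- The iterated derivative of a test function as a bounded continuous function. -/
noncomputable def derivBCF (i : ℕ) (g : Test d) : Rd d →ᵇ FormSpace d i :=
  BoundedContinuousFunction.ofNormedAddCommGroup (iterD i g) (g.contDiff_iterD i).continuous
    ((g.contDiff_iterD i).continuous.bounded_above_of_compact_support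
      (g.hasCompactSupport_iterD i)).choose
    ((g.contDiff_iterD i).continuous.bounded_above_of_compact_support
      (g.hasCompactSupport_iterD i)).choose_spec

@[simp]
theorem derivBCF_apply (i : ℕ) (g : Test d) (x : Rd d) : derivBCF i g x = iterD i g x := rfl

theorem iterD_translateTest (i : ℕ) (g : Test d) (y x : Rd d) :
    iterD i (translateTest (-y) g) x = iterD i g (x - y) :=
  (iterD_comp_add_right i g (-y) x).trans (by rw [sub_eq_add_neg])

theorem continuous_derivBCF_translateTest (i : ℕ) (g : Test d) :
    Continuous fun y => derivBCF i (translateTest (-y) g) := by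
  have huc : UniformContinuous (iterD i g) :=
    (g.hasCompactSupport_iterD i).uniformContinuous_of_continuous (g.contDiff_iterD i).continuous
  rw [Metric.continuous_iff]
  intro y₀ ε hε
  obtain ⟨δ, hδ, h⟩ := Metric.uniformContinuous_iff.1 huc (ε / 2) (half_pos hε)
  refine ⟨δ, hδ, fun y hy => lt_of_le_of_lt ?_ (half_lt_self hε)⟩
  rw [BoundedContinuousFunction.dist_le (half_pos hε).le]
  intro x
  rw [derivBCF_apply, derivBCF_apply, iterD_translateTest, iterD_translateTest]
  exact (h (by rwa [dist_sub_left])).le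

/-- On the test functions supported in a fixed compact set, a distribution is a continuous
functional of finitely many derivatives. -/
theorem exists_eq_apply_derivBCF (u : Distr d) {K : Set (Rd d)} (hK : IsCompact K) :
    ∃ (s : Finset ℕ) (U : ((i : s) → Rd d →ᵇ FormSpace d i) →L[ℝ] ℂ),
      ∀ g : Test d, Function.support g ⊆ K → u g = U fun i => derivBCF i g := by
  let K' : TopologicalSpace.Compacts (Rd d) := ⟨K, hK⟩
  let incl : 𝓓_{K'}(Rd d, ℝ) →L[ℝ] Test d :=
    TestFunction.ofSupportedInCLM ℝ (fun _ _ => trivial)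
  let uK : 𝓓_{K'}(Rd d, ℝ) →ₗ[ℝ] ℂ :=
    { toFun := fun g => u (incl g)
      map_add' := fun f g => by rw [map_add, map_add]
      map_smul' := fun c f => by rw [map_smul, map_smul, RingHom.id_apply] }
  have hcont : Continuous uK := (map_continuous u).comp incl.continuous
  obtain ⟨s, C, -, hC⟩ := Seminorm.bound_of_continuous
    (ContDiffMapSupportedIn.withSeminorms ℝ (Rd d) ℝ ⊤ K')
    ((normSeminorm ℝ ℂ).comp uK) (continuous_norm.comp hcont)
  have hadd : ∀ (i : ℕ) (f g : 𝓓_{K'}(Rd d, ℝ)),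
      derivBCF i (incl (f + g)) = derivBCF i (incl f) + derivBCF i (incl g) := fun i f g => by
    ext1 x
    exact DFunLike.congr_fun
      (map_add (ContDiffMapSupportedIn.structureMapLM ℝ ⊤ i) f g) x
  have hsmul : ∀ (i : ℕ) (c : ℝ) (f : 𝓓_{K'}(Rd d, ℝ)),
      derivBCF i (incl (c • f)) = c • derivBCF i (incl f) := fun i c f => by
    ext1 x
    exact DFunLike.congr_fun
      (map_smul (ContDiffMapSupportedIn.structureMapLM ℝ ⊤ i) c f) x
  let J : 𝓓_{K'}(Rd d, ℝ) →ₗ[ℝ] ((i : s) → Rd d →ᵇ FormSpace d i) :=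
    { toFun := fun g i => derivBCF i (incl g)
      map_add' := fun f g => funext fun i => hadd i f g
      map_smul' := fun c f => funext fun i => hsmul i c f }
  have hbound : ∀ g, ‖uK g‖ ≤ C * ‖J g‖ := by
    intro g
    refine (hC g).trans ?_
    rw [smul_apply, NNReal.smul_def, smul_eq_mul]
    refine mul_le_mul_of_nonneg_left ?_ C.2
    refine Seminorm.finset_sup_apply_le (norm_nonneg (J g)) fun i hi => ?_
    rw [ContDiffMapSupportedIn.seminorm_top_le_iff ℝ (norm_nonneg (J g))]
    exact fun x _ => ((derivBCF i (incl g)).norm_coe_le_norm x).trans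
      (norm_le_pi_norm (J g) ⟨i, hi⟩)
  obtain ⟨U, hU⟩ := exists_continuousLinearMap_comp_eq uK J C hbound
  exact ⟨s, U, fun g hg =>
    (hU (ContDiffMapSupportedIn.of_support_subset g.contDiff hg)).symm⟩

theorem support_translateTest_subset (y : Rd d) (g : Test d) :
    Function.support (translateTest (-y) g) ⊆ {y} + tsupport g := by
  intro x hx
  refine ⟨y, rfl, x + -y, subset_tsupport _ hx, by simp⟩

/-! ### Regularization and convolution -/

/-- The regularization `y ↦ u (g (· - y))` of a distribution. -/
noncomputable def regularize (u : Distr d) (g : Test d) (y : Rd d) : ℂ := u (translateTest (-y) g)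

/-- For `y` near `y₀` the translates are supported in one compact set, where `u` is a continuous
functional of derivatives that depend continuously on `y` in the sup norm. -/
theorem continuous_regularize (u : Distr d) (g : Test d) : Continuous (regularize u g) := by
  rw [continuous_iff_continuousAt]
  intro y₀
  obtain ⟨s, U, hU⟩ := exists_eq_apply_derivBCF u
    ((isCompact_closedBall y₀ 1).add g.hasCompactSupport.isCompact)
  have hc : Continuous fun y => U fun i => derivBCF i (translateTest (-y) g) :=
    U.continuous.comp (continuous_pi fun i => continuous_derivBCF_translateTest i g)
  refine hc.continuousAt.congr ?_
  filter_upwards [Metric.closedBall_mem_nhds y₀ one_pos] with y hy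
  exact (hU _ ((support_translateTest_subset y g).trans
    (add_subset_add_right (singleton_subset_iff.2 hy)))).symm

theorem iterD_convolution {g : Rd d → ℝ} (hg : LocallyIntegrable g) (ψ : Test d) (i : ℕ)
    (x : Rd d) : iterD i (g ⋆[ContinuousLinearMap.lsmul ℝ ℝ] ψ) x =
      ∫ y, g y • iterD i ψ (x - y) := by
  induction i generalizing x with
  | zero =>
    rw [iterD_zero, convolution, ← ContinuousLinearEquiv.integral_comp_comm]
    simp only [iterD_zero, ContinuousLinearMap.lsmul_apply, map_smul]
  | succ i ih =>
    have hconv : iterD i (g ⋆[ContinuousLinearMap.lsmul ℝ ℝ] ψ) =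
        g ⋆[ContinuousLinearMap.lsmul ℝ ℝ] (iterD i ψ) := funext ih
    rw [iterD_succ, hconv, ((ψ.hasCompactSupport_iterD i).hasFDerivAt_convolution_right
      (ContinuousLinearMap.lsmul ℝ ℝ) hg (ψ.contDiff_iterD i) x).fderiv, convolution,
      ← ContinuousLinearEquiv.integral_comp_comm]
    refine integral_congr_ae (Filter.Eventually.of_forall fun y => ?_)
    simp only [iterD_succ]
    rw [← map_smul]
    congr 1

/-- The convolution of two test functions. -/
noncomputable def convTest (g ψ : Test d) : Test d where
  toFun := (g : Rd d → ℝ) ⋆[ContinuousLinearMap.lsmul ℝ ℝ] ψ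
  contDiff' := ψ.hasCompactSupport.contDiff_convolution_right (n := ⊤)
    (ContinuousLinearMap.lsmul ℝ ℝ) g.continuous.locallyIntegrable ψ.contDiff
  hasCompactSupport' := HasCompactSupport.convolution (ContinuousLinearMap.lsmul ℝ ℝ)
    g.hasCompactSupport ψ.hasCompactSupport
  tsupport_subset' := fun _ _ => trivial

theorem convTest_apply (g ψ : Test d) (x : Rd d) : convTest g ψ x = ∫ y, g y * ψ (x - y) := rfl

theorem convTest_comm (g ψ : Test d) : convTest g ψ = convTest ψ g := by
  ext x
  rw [convTest_apply, convTest_apply, ← integral_sub_left_eq_self _ _ x]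
  simp [mul_comm]

theorem continuous_smul_derivBCF (i : ℕ) (g ψ : Test d) :
    Continuous fun y => g y • derivBCF i (translateTest (-y) ψ) :=
  Continuous.smul (f := g) g.continuous (continuous_derivBCF_translateTest i ψ)

theorem integrable_smul_derivBCF (i : ℕ) (g ψ : Test d) :
    Integrable fun y => g y • derivBCF i (translateTest (-y) ψ) :=
  (continuous_smul_derivBCF i g ψ).integrable_of_hasCompactSupport
    (HasCompactSupport.smul_right (f := g)
      (f' := fun y => derivBCF i (translateTest (-y) ψ)) g.hasCompactSupport)

theorem derivBCF_convTest (i : ℕ) (g ψ : Test d) :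
    derivBCF i (convTest g ψ) = ∫ y, g y • derivBCF i (translateTest (-y) ψ) := by
  ext1 x
  have h := (BoundedContinuousFunction.evalCLM ℝ x).integral_comp_comm
    (integrable_smul_derivBCF i g ψ)
  refine Eq.trans ?_ h
  refine (iterD_convolution g.continuous.locallyIntegrable ψ i x).trans ?_
  refine integral_congr_ae (Filter.Eventually.of_forall fun y => ?_)
  exact congrArg (g y • ·) (iterD_translateTest i ψ y x).symm

/-- The derivatives of the convolution are Bochner integrals of those of translates of `ψ`, and the
continuous functional `U` commutes with the integral. -/
theorem apply_convTest (u : Distr d) (g ψ : Test d) :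
    u (convTest g ψ) = ∫ y, (g y : ℂ) * regularize u ψ y := by
  obtain ⟨s, U, hU⟩ := exists_eq_apply_derivBCF u
    (g.hasCompactSupport.isCompact.add ψ.hasCompactSupport.isCompact)
  have hint : Integrable fun y => fun i : s => g y • derivBCF (i : ℕ) (translateTest (-y) ψ) :=
    Integrable.of_eval fun i => integrable_smul_derivBCF i g ψ
  have h1 : (fun i : s => derivBCF (i : ℕ) (convTest g ψ)) =
      ∫ y, fun i : s => g y • derivBCF (i : ℕ) (translateTest (-y) ψ) := by
    ext1 i
    rw [eval_integral (ι := s) fun i : s => integrable_smul_derivBCF (i : ℕ) g ψ]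
    exact derivBCF_convTest i g ψ
  have hsupp : Function.support (convTest g ψ) ⊆ tsupport g + tsupport ψ :=
    (support_convolution_subset (ContinuousLinearMap.lsmul ℝ ℝ)).trans
      (add_subset_add (subset_tsupport _) (subset_tsupport _))
  rw [hU _ hsupp, h1, ← U.integral_comp_comm hint]
  refine integral_congr_ae (Filter.Eventually.of_forall fun y => ?_)
  refine (map_smul U (g y) fun i : s => derivBCF (i : ℕ) (translateTest (-y) ψ)).trans ?_
  rw [Complex.real_smul]
  by_cases hy : g y = 0
  · simp only [hy, Complex.ofReal_zero, zero_mul]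
  · change _ = (g y : ℂ) * u (translateTest (-y) ψ)
    rw [hU _ ((support_translateTest_subset y ψ).trans
      (add_subset_add_right (singleton_subset_iff.2 (subset_tsupport _ hy))))]

/-! ### Distribution solutions are continuous functions -/

theorem regularize_modDiffDistr (φ : Rd d → ℂ) (y : Rd d) (u : Distr d) (g : Test d) :
    regularize (modDiffDistr φ y u) g = modDiff φ y (regularize u g) := by
  ext x
  change u (translateTest (-y) (translateTest (-x) g)) - φ y • u (translateTest (-x) g) = _
  rw [translateTest_translateTest, ← neg_add_rev]
  rfl

theorem regularize_modDiffDistr_iterate (φ : Rd d → ℂ) (y : Rd d) (u : Distr d) (g : Test d)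
    (n : ℕ) : regularize ((modDiffDistr φ y)^[n] u) g = (modDiff φ y)^[n] (regularize u g) := by
  induction n with
  | zero => rfl
  | succ n ih => rw [Function.iterate_succ_apply', Function.iterate_succ_apply',
      regularize_modDiffDistr, ih]

theorem regularize_zero_apply (u : Distr d) (g : Test d) : regularize u g 0 = u g := by
  rw [regularize, neg_zero]
  congr 1
  ext x
  simp

theorem integrable_test_mul (g : Test d) {f : Rd d → ℂ} (hf : Continuous f) :
    Integrable fun x => (g x : ℂ) * f x := by
  refine Continuous.integrable_of_hasCompactSupport
    ((Complex.continuous_ofReal.comp g.continuous).mul hf) ?_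
  exact (g.hasCompactSupport.comp_left Complex.ofReal_zero).mul_right

theorem eq_zero_of_integral_test_mul {f : Rd d → ℂ} (hf : Continuous f)
    (h : ∀ g : Test d, ∫ x, (g x : ℂ) * f x = 0) : f = 0 := by
  refine Measure.eq_of_ae_eq (μ := volume) ?_ hf continuous_const
  refine ae_eq_zero_of_integral_contDiff_smul_eq_zero hf.locallyIntegrable fun g hg hgs => ?_
  simp only [Complex.real_smul]
  exact h ⟨g, hg, hgs, fun _ _ => trivial⟩

/-- `u g` is the value at 0 of `regularize u g`, which lies in the finite-dimensional `W`. On `W`,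
evaluation at 0 is a combination of integrals against test functions ψ, and by commutativity of
convolution the integral of `regularize u g` against ψ is that of `regularize u ψ` against `g`. So
`u` is the same combination of the continuous functions `regularize u ψ`. -/
theorem exists_continuous_isGivenBy {t : ℕ} {n : Fin t → ℕ} {h : Fin t → Rd d} {u : Distr d}
    {φ : Rd d → ℂ} (hd : Dense (AddSubgroup.closure (Set.range h) : Set (Rd d)))
    (hu : ∀ k, (modDiffDistr φ (h k))^[n k + 1] u = 0) :
    ∃ f : Rd d → ℂ, Continuous f ∧ IsGivenBy u f := by
  by_cases hu0 : u = 0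
  · refine ⟨0, continuous_const, continuous_const.locallyIntegrable, fun g => ?_⟩
    simp [hu0]
  have hmem : ∀ g, regularize u g ∈ solSpace h (fun k => φ (h k)) (fun k => n k + 1) := by
    refine fun g => ⟨continuous_regularize u g, fun k => ?_⟩
    rw [← modDiff_iterate, ← regularize_modDiffDistr_iterate, hu]
    rfl
  -- With φ(h_k) = 0 the equation would say that a power of an invertible translation kills every
  -- regularization, whence `u = 0`.
  have hφ : ∀ k, φ (h k) ≠ 0 := by
    intro k hk
    refine hu0 (DFunLike.ext _ _ fun g => ?_)
    have h0 := (hmem g).2 k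
    have hshift : diffOp (φ (h k)) (h k) = shift (h k) := by
      rw [hk, diffOp, zero_smul, sub_zero]
    have hinv : shift (-h k) * shift (h k) = 1 := by
      rw [← shift_add, neg_add_cancel, shift_zero]
    have hpow : shift (-h k) ^ (n k + 1) * shift (h k) ^ (n k + 1) = 1 := by
      rw [← (shift_commute _ _).mul_pow, hinv, one_pow]
    rw [hshift] at h0
    have h1 : regularize u g = 0 := by
      rw [← Module.End.one_apply (R := ℂ) (regularize u g), ← hpow, Module.End.mul_apply, h0,
        map_zero]
    exact (regularize_zero_apply u g).symm.trans (congrFun h1 0)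
  let W := solSpace h (fun k => φ (h k)) (fun k => n k + 1)
  have : FiniteDimensional ℂ W := finiteDimensional_solSpace hφ hd
  let I : Test d → Module.Dual ℂ W := fun ψ =>
    { toFun := fun w => ∫ x, (ψ x : ℂ) * (w : Rd d → ℂ) x
      map_add' := fun v w => by
        rw [← integral_add (integrable_test_mul ψ v.2.1) (integrable_test_mul ψ w.2.1)]
        simp [mul_add]
      map_smul' := fun c w => by
        rw [RingHom.id_apply, smul_eq_mul, ← integral_const_mul]
        simp [mul_left_comm] }
  have hspan : Submodule.span ℂ (Set.range I) = ⊤ :=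
    span_dual_eq_top fun w hw =>
      Subtype.ext (eq_zero_of_integral_test_mul w.2.1 fun ψ => hw _ ⟨ψ, rfl⟩)
  have key : ∀ l : Module.Dual ℂ W, ∃ f : Rd d → ℂ, Continuous f ∧
      ∀ g, l ⟨regularize u g, hmem g⟩ = ∫ x, (g x : ℂ) * f x := by
    intro l
    have hl : l ∈ Submodule.span ℂ (Set.range I) := hspan ▸ trivial
    induction hl using Submodule.span_induction with
    | mem l hl =>
      obtain ⟨ψ, rfl⟩ := hl
      refine ⟨regularize u ψ, continuous_regularize u ψ, fun g => ?_⟩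
      rw [← apply_convTest, convTest_comm, apply_convTest]
      rfl
    | zero => exact ⟨0, continuous_const, fun g => by simp⟩
    | add l l' _ _ ih ih' =>
      obtain ⟨f, hf, hlf⟩ := ih
      obtain ⟨f', hf', hlf'⟩ := ih'
      refine ⟨f + f', hf.add hf', fun g => ?_⟩
      rw [LinearMap.add_apply, hlf, hlf',
        ← integral_add (integrable_test_mul g hf) (integrable_test_mul g hf')]
      simp [mul_add]
    | smul a l _ ih =>
      obtain ⟨f, hf, hlf⟩ := ih
      refine ⟨a • f, hf.const_smul a, fun g => ?_⟩
      rw [LinearMap.smul_apply, hlf, smul_eq_mul, ← integral_const_mul]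
      simp [mul_left_comm]
  obtain ⟨f, hf, hlf⟩ := key (LinearMap.proj 0 ∘ₗ W.subtype)
  exact ⟨f, hf, hf.locallyIntegrable, fun g => by rw [← regularize_zero_apply, ← hlf]; rfl⟩

theorem IsGivenBy.modDiffDistr {u : Distr d} {f : Rd d → ℂ} (hu : IsGivenBy u f)
    (hf : Continuous f) (φ : Rd d → ℂ) (y : Rd d) :
    IsGivenBy (modDiffDistr φ y u) (modDiff φ y f) := by
  have hfy : Continuous fun x => f (x + y) := by fun_prop
  have hfφ : Continuous fun x => φ y * f x := by fun_prop
  refine ⟨(hfy.sub hfφ).locallyIntegrable, fun g => ?_⟩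
  change u (translateTest (-y) g) - φ y • u g = _
  have h1 : ∫ x, (translateTest (-y) g x : ℂ) * f x = ∫ x, (g x : ℂ) * f (x + y) := by
    rw [← integral_add_right_eq_self _ y]
    simp
  have h2 : φ y • ∫ x, (g x : ℂ) * f x = ∫ x, (g x : ℂ) * (φ y * f x) := by
    rw [smul_eq_mul, ← integral_const_mul]
    simp [mul_left_comm]
  rw [hu.2, hu.2, h1, h2, ← integral_sub (integrable_test_mul g hfy) (integrable_test_mul g hfφ)]
  simp [modDiff, mul_sub]

theorem IsGivenBy.eq_zero {f : Rd d → ℂ} (h : IsGivenBy (0 : Distr d) f) (hf : Continuous f) :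
    f = 0 :=
  eq_zero_of_integral_test_mul hf fun g => (h.2 g).symm

theorem IsGivenBy.modDiff_iterate_eq_zero {u : Distr d} {f : Rd d → ℂ} (hu : IsGivenBy u f)
    (hf : Continuous f) {φ : Rd d → ℂ} {y : Rd d} {n : ℕ} (h : (Montel.modDiffDistr φ y)^[n] u = 0) :
    (modDiff φ y)^[n] f = 0 := by
  have key : ∀ n : ℕ, Continuous ((modDiff φ y)^[n] f) ∧
      IsGivenBy ((Montel.modDiffDistr φ y)^[n] u) ((modDiff φ y)^[n] f) := by
    intro n
    induction n with
    | zero => exact ⟨hf, hu⟩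
    | succ n ih =>
      rw [Function.iterate_succ_apply', Function.iterate_succ_apply']
      refine ⟨?_, ih.2.modDiffDistr ih.1 φ y⟩
      exact (ih.1.comp (continuous_id.add continuous_const)).sub (continuous_const.mul ih.1)
  have h2 := (key n).2
  rw [h] at h2
  exact h2.eq_zero (key n).1

theorem IsGivenBy.ne_zero {u : Distr d} {f : Rd d → ℂ} (h : IsGivenBy u f) (hu : u ≠ 0) :
    f ≠ 0 := by
  rintro rfl
  exact hu (DFunLike.ext _ _ fun g => (h.2 g).trans (by simp))

theorem IsExpMonomialFor.continuous {G : Type*} [AddCommGroup G] [TopologicalSpace G]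
    {f e : G → ℂ} (h : IsExpMonomialFor f e) : Continuous f := by
  obtain ⟨he, p, ⟨k, P, a, hp⟩, hf⟩ := h
  have : f = fun x => MvPolynomial.eval (fun i => a i x) P * e x := funext fun x => by
    rw [hf, hp]
  rw [this]
  exact ((MvPolynomial.continuous_eval P).comp
    (continuous_pi fun i => (a i).continuous_toFun)).mul he.1

end Montel

theorem theorem15 (t : ℕ) (ht : 0 < t) (n : Fin t → ℕ) :
    -- a group without topology is a discrete group
    (∀ (G : Type*) [AddCommGroup G] [TopologicalSpace G] [DiscreteTopology G]
        (h : Fin t → G) (f φ : G → ℂ),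
      AddSubgroup.closure (Set.range h) = ⊤ →
      f ≠ 0 →
      (∀ k, (Montel.modDiff φ (h k))^[n k + 1] f = 0) →
      Montel.IsExpMonomial f ∧
        ∀ e : G → ℂ, Montel.IsExpMonomialFor f e →
          (∀ i, e (h i) = φ (h i)) ∧
          ∀ m : ℕ, (∀ y, (Montel.modDiff φ y)^[m + 1] f = 0) →
            φ = e ∧ Montel.IsExponential φ) ∧
    (∀ (G : Type*) [AddCommGroup G] [TopologicalSpace G] [IsTopologicalAddGroup G]
        (h : Fin t → G) (f φ : G → ℂ),
      Dense (AddSubgroup.closure (Set.range h) : Set G) →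
      Continuous f →
      f ≠ 0 →
      (∀ k, (Montel.modDiff φ (h k))^[n k + 1] f = 0) →
      Montel.IsExpMonomial f ∧
        ∀ e : G → ℂ, Montel.IsExpMonomialFor f e →
          (∀ i, e (h i) = φ (h i)) ∧
          ∀ m : ℕ, (∀ y, (Montel.modDiff φ y)^[m + 1] f = 0) →
            φ = e ∧ Montel.IsExponential φ) ∧
    (∀ (d : ℕ) (h : Fin t → Montel.Rd d) (u : Montel.Distr d) (φ : Montel.Rd d → ℂ),
      Dense (AddSubgroup.closure (Set.range h) : Set (Montel.Rd d)) →
      u ≠ 0 →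
      (∀ k, (Montel.modDiffDistr φ (h k))^[n k + 1] u = 0) →
      Montel.IsExpMonomialDistr u ∧
        ∀ e : Montel.Rd d → ℂ, Montel.IsExpMonomialDistrFor u e →
          (∀ i, e (h i) = φ (h i)) ∧
          ∀ m : ℕ, (∀ y, (Montel.modDiffDistr φ y)^[m + 1] u = 0) →
            φ = e ∧ Montel.IsExponential φ) := by
  refine ⟨fun G _ _ _ h f φ hd hf0 hf => ?_, fun G _ _ _ h f φ hd hfc hf0 hf => ?_,
    fun d h u φ hd hu0 hu => ?_⟩
  · refine Montel.isExpMonomial_and_unique ?_ continuous_of_discreteTopology hf0 hf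
    rw [hd]
    exact dense_univ
  · exact Montel.isExpMonomial_and_unique hd hfc hf0 hf
  · obtain ⟨f, hfc, huf⟩ := Montel.exists_continuous_isGivenBy hd hu
    refine ⟨⟨f, (Montel.isExpMonomial_and_unique hd hfc (huf.ne_zero hu0)
      fun k => huf.modDiff_iterate_eq_zero hfc (hu k)).1, huf⟩, ?_⟩
    -- No comparison of `f'` with `f` is needed: `f'` is continuous and represents `u`, so it
    -- satisfies the difference equations itself.
    rintro e ⟨f', hfe, huf'⟩
    have hf'c := hfe.continuous
    obtain ⟨h1, h2⟩ := (Montel.isExpMonomial_and_unique hd hf'c (huf'.ne_zero hu0)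
      fun k => huf'.modDiff_iterate_eq_zero hf'c (hu k)).2 e hfe
    exact ⟨h1, fun m hm => h2 m fun y => huf'.modDiff_iterate_eq_zero hf'c (hm y)⟩
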